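/- Let $K\ge 1$ and $d>0$, let $x_1,\dots,x_K$ be distinct points of the circle $\mathbb R/\mathbb Z$ and let $$G^{per}(x,y)=\frac{\cosh\left(\left(l-\tfrac12\right)/d\right)}{2d\,\sinh\left(1/(2d)\right)},$$ where $l$ is the arc distance of $x$ and $y$ (for $x,y\in[0,1)$, $l=\min(|x-y|,1-|x-y|)$). Suppose that $V_1,\dots,V_K>0$ solve $$V_k=\sum_{j=1}^K V_j^2\,G^{per}(x_k,x_j),\qquad k=1,\dots,K,$$ and let $M_{kj}=2V_j\,G^{per}(x_k,x_j)$. On the cycle graph with node set $\mathbb Z/n$, node $i$ being placed at $i/n\in\mathbb R/\mathbb Z$, consider the system $$u_t=-u+u^2/v,\qquad 0=d^2n^2\,\mathcal L v-v+u^2,\qquad (\mathcal L v)(i)=v(i+1)+v(i-1)-2v(i)$$ (that is, $D_u=0$, $D_v=d^2n^2$, $\tau=0$). A steady state $(u,v)$ always has $v>0$. For nodes $p_1,\dots,p_K$ we say that $(u,v)$ has the *$K$-spike profile up to a relative error $\varepsilon$, with spikes at $p_1,\dots,p_K$*, if $u(i)=0$ for every node $i\notin\{p_1,\dots,p_K\}$,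 $|u(p_k)-nV_k|\le\varepsilon\, nV_k$ for all $k$, and $|v(i)-S(i)|\le\varepsilon\, S(i)$ at every node $i$, where $S(i)=\sum_{j} nV_j^2\,G^{per}(i/n,x_j)$. An *eigenvalue of the linearisation* at $(u,v)$ is a $\lambda\in\mathbb C$ for which there is $(\phi,\psi)\ne(0,0)$ with $$\lambda\phi=-\phi+2\frac uv\phi-\frac{u^2}{v^2}\psi,\qquad 0=d^2n^2\,\mathcal L\psi-\psi+2u\phi .$$ 1. (Existence.) If $I-M$ is invertible, then for every $\varepsilon>0$ there are $\delta>0$ and $N$ such that for all $n\ge N$ and all nodes $p_1,\dots,p_K$ with $p_k/n$ within arc distance $\delta$ of $x_k$ for every $k$, there is a steady state having the $K$-spike profile up to a relative error $\varepsilon$, with spikes at $p_1,\dots,p_K$. 2. (Stability.) Suppose that $I-M$ has no eigenvalue with positive real part. (a) If $I-M$ is invertible, then there are $\varepsilon,\delta>0$ and $N$ such that for all $n\ge N$ and all nodes $p_k$ with $p_k/n$ within $\delta$ of $x_k$ for every $k$, every steady state having the $K$-spike profile up to a relative error $\varepsilon$, with spikes at $p_1,\dots,p_K$, is linearly stable: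 every eigenvalue $\lambda$ of the linearisation satisfies $\operatorname{Re}\lambda<0$. (b) Whether or not $I-M$ is invertible, such a state is stable to leading order: for every $\eta>0$ there are $\varepsilon,\delta>0$ and $N$ such that for all $n\ge N$, all $p_k$ and all steady states as in (a), every eigenvalue $\lambda$ of the linearisation satisfies $\operatorname{Re}\lambda\le\eta$. -/

import Mathlib

open scoped BigOperators

/-- The Laplacian `(L f)(i) = ∑_{j ∼ i} (f j - f i)` of the cycle graph with node set `ZMod n`. -/
def cycleLaplacian {n : ℕ} {R : Type*} [Ring R] (f : ZMod n → R) (i : ZMod n) : R :=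
  (f (i + 1) - f i) + (f (i - 1) - f i)

/-- `(u, v)` (with `v > 0`, so that `u ^ 2 / v` makes sense) is a rest point of
`u_t = Du L u - u + u ^ 2 / v`, `τ v_t = Dv L v - v + u ^ 2` on the cycle graph. -/
structure IsSteadyState {n : ℕ} (Du Dv : ℝ) (u v : ZMod n → ℝ) : Prop where
  pos : ∀ i, 0 < v i
  eq_u : ∀ i, Du * cycleLaplacian u i - u i + u i ^ 2 / v i = 0
  eq_v : ∀ i, Dv * cycleLaplacian v i - v i + u i ^ 2 = 0

/-- `z` is an eigenvalue of the linearisation at `(u, v)`: the perturbation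
`(u, v) + exp (z t) (φ, ψ)` solves the linearised system for some `(φ, ψ) ≠ 0`. -/
def IsGrowthRate {n : ℕ} (Du Dv τ : ℝ) (u v : ZMod n → ℝ) (z : ℂ) : Prop :=
  ∃ φ ψ : ZMod n → ℂ, (φ ≠ 0 ∨ ψ ≠ 0) ∧
    (∀ i, z * φ i = (Du : ℂ) * cycleLaplacian φ i - φ i
      + 2 * ((u i / v i : ℝ) : ℂ) * φ i - ((u i ^ 2 / v i ^ 2 : ℝ) : ℂ) * ψ i) ∧
    (∀ i, (τ : ℂ) * z * ψ i = (Dv : ℂ) * cycleLaplacian ψ i - ψ i + 2 * (u i : ℂ) * φ i)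

/-- Linear stability: all eigenvalues of the linearisation lie in the open left half-plane. -/
def IsLinearlyStable {n : ℕ} (Du Dv τ : ℝ) (u v : ZMod n → ℝ) : Prop :=
  ∀ z : ℂ, IsGrowthRate Du Dv τ u v z → z.re < 0

/-- The periodic Green's function of `d ^ 2 G'' - G + δ = 0` on the circle of length one. The norm
`‖x - y‖` on `ℝ / ℤ` is the arc distance `min |s - t| (1 - |s - t|)` of representatives
`s, t ∈ [0, 1)`. -/
noncomputable def Gper (d : ℝ) (x y : UnitAddCircle) : ℝ :=
  Real.cosh ((‖x - y‖ - 1 / 2) / d) / (2 * d * Real.sinh (1 / (2 * d)))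

/-- The matrix `M k j = 2 V j G (x k, x j)`. -/
noncomputable def spikeMatrix {K : ℕ} (d : ℝ) (x : Fin K → UnitAddCircle) (V : Fin K → ℝ) :
    Matrix (Fin K) (Fin K) ℝ :=
  Matrix.of fun k j => 2 * V j * Gper d (x k) (x j)

/-- The node `i` of the `n`-cycle sits at `i / n` on the circle; every spike node `p k` lies within
`δ` of the location `x k`. -/
def NodesNear {K n : ℕ} [NeZero n] (δ : ℝ) (x : Fin K → UnitAddCircle) (p : Fin K → ZMod n) :
    Prop :=
  ∀ k, ‖ZMod.toAddCircle (p k) - x k‖ ≤ δ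

/-- `(u, v)` has the `K`-spike profile with spikes at the nodes `p k`: `u` vanishes off the spikes,
`u (p k) = n V k (1 + O(ε))`, and `v = n ∑ j, V j ^ 2 G (·, x j) (1 + O(ε))` at every node, where
`O(ε)` stands for a relative error of at most `ε`. -/
structure HasSpikeProfile {K n : ℕ} [NeZero n] (ε d : ℝ) (x : Fin K → UnitAddCircle)
    (V : Fin K → ℝ) (p : Fin K → ZMod n) (u v : ZMod n → ℝ) : Prop where
  off : ∀ i, i ∉ Set.range p → u i = 0
  spike : ∀ k, |u (p k) - n * V k| ≤ ε * (n * V k)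
  profile : ∀ i, |v i - ∑ j, n * V j ^ 2 * Gper d (ZMod.toAddCircle i) (x j)|
    ≤ ε * ∑ j, n * V j ^ 2 * Gper d (ZMod.toAddCircle i) (x j)

open Filter Topology

/-! Since $D_u=0$, each node has $u=0$ or $u=v$, so a spike state is a finite problem. Solving for
$v$ with the Green's function $g$ of the cycle and writing $u(p_k)=n\xi_k$, the steady states are
the positive solutions of $\xi_k=\sum_j\xi_j^2\,n g(p_k-p_j)$. The function $g$ is explicit and $n
g\to G^{per}$ uniformly (`exists_abs_mul_cycleGreen_sub_le`), so this system is a perturbation of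
the one for $V$, whose Jacobian there is $I-M$. The inverse function theorem gives existence
(`eventually_exists_reduced`).

The linearisation reduces likewise: an eigenvalue is $-1$ or lies in the spectrum of a $K\times K$
matrix close to $I-M$ (`IsGrowthRate.eq_or_mem_spectrum`). Upper hemicontinuity of the spectrum
gives (b). For (a), $M$ is a symmetric matrix times a positive diagonal one, so $I-M$ has real
spectrum; invertibility then excludes the imaginary axis. -/

/-! ### Green's function of the cycle -/

/-- The exponential rate of the Green's function of `d ^ 2 * n ^ 2 * L - 1` on the `n`-cycle. -/
noncomputable def cycleGreenRate (d : ℝ) (n : ℕ) : ℝ := 2 * Real.arsinh (1 / (2 * d * n))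

/-- The amplitude of the Green's function of `d ^ 2 * n ^ 2 * L - 1` on the `n`-cycle. -/
noncomputable def cycleGreenAmp (d : ℝ) (n : ℕ) : ℝ :=
  1 / (2 * (d ^ 2 * (n : ℝ) ^ 2) * Real.sinh (cycleGreenRate d n) *
    Real.sinh (cycleGreenRate d n * n / 2))

/-- The Green's function of `d ^ 2 * n ^ 2 * L - 1` on the `n`-cycle. -/
noncomputable def cycleGreen (d : ℝ) {n : ℕ} (m : ZMod n) : ℝ :=
  cycleGreenAmp d n * Real.cosh (cycleGreenRate d n * (m.val - n / 2))

lemma cycleGreenRate_pos {d : ℝ} (hd : 0 < d) (n : ℕ) [NeZero n] : 0 < cycleGreenRate d n := by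
  have hn : (0 : ℝ) < n := Nat.cast_pos.2 (NeZero.pos n)
  have : 0 < Real.arsinh (1 / (2 * d * n)) := Real.arsinh_pos_iff.2 (by positivity)
  unfold cycleGreenRate
  positivity

lemma cycleGreenAmp_pos {d : ℝ} (hd : 0 < d) (n : ℕ) [NeZero n] : 0 < cycleGreenAmp d n := by
  have hn : (0 : ℝ) < n := Nat.cast_pos.2 (NeZero.pos n)
  have ha := cycleGreenRate_pos hd n
  have h1 : 0 < Real.sinh (cycleGreenRate d n) := Real.sinh_pos_iff.2 ha
  have h2 : 0 < Real.sinh (cycleGreenRate d n * n / 2) := Real.sinh_pos_iff.2 (by positivity)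
  unfold cycleGreenAmp
  positivity

lemma cycleGreen_pos {d : ℝ} (hd : 0 < d) {n : ℕ} [NeZero n] (m : ZMod n) :
    0 < cycleGreen d m :=
  mul_pos (cycleGreenAmp_pos hd n) (Real.cosh_pos _)

lemma cycleGreenRate_eq {d : ℝ} (hd : 0 < d) (n : ℕ) [NeZero n] :
    d ^ 2 * (n : ℝ) ^ 2 * (2 * Real.cosh (cycleGreenRate d n) - 2) = 1 := by
  have hn : (0 : ℝ) < n := Nat.cast_pos.2 (NeZero.pos n)
  rw [cycleGreenRate, Real.cosh_two_mul, Real.cosh_sq, Real.sinh_arsinh]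
  field_simp
  ring

/-- No reduction mod `n` is needed: the wrap from `n` to `0` is absorbed by the symmetry of `cosh`
about `n / 2`. -/
lemma cycleGreen_add_one (d : ℝ) {n : ℕ} [NeZero n] (m : ZMod n) :
    cycleGreen d (m + 1) =
      cycleGreenAmp d n * Real.cosh (cycleGreenRate d n * (m.val + 1 - n / 2)) := by
  have hm := ZMod.val_lt m
  have hv : (m + 1).val = (m.val + 1) % n := by
    conv_lhs => rw [← ZMod.natCast_zmod_val m]
    rw [← Nat.cast_succ, ZMod.val_natCast]
  unfold cycleGreen
  rcases Nat.lt_or_ge (m.val + 1) n with h | h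
  · rw [hv, Nat.mod_eq_of_lt h]
    push_cast
    ring_nf
  · have h' : m.val + 1 = n := by omega
    have h2 : (m.val : ℝ) + 1 = n := by exact_mod_cast h'
    rw [hv, h', Nat.mod_self, h2, ← Real.cosh_neg]
    push_cast
    ring_nf

lemma cycleGreen_neg (d : ℝ) {n : ℕ} [NeZero n] (m : ZMod n) :
    cycleGreen d (-m) = cycleGreen d m := by
  unfold cycleGreen
  rw [ZMod.neg_val]
  split_ifs with h
  · simp [h]
  · rw [Nat.cast_sub (ZMod.val_lt m).le, ← Real.cosh_neg]
    ring_nf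

/-- At `m = 0` the formula fails; this kink produces the point source. -/
lemma cycleGreen_sub_one (d : ℝ) {n : ℕ} [NeZero n] {m : ZMod n} (hm : m ≠ 0) :
    cycleGreen d (m - 1) =
      cycleGreenAmp d n * Real.cosh (cycleGreenRate d n * (m.val - 1 - n / 2)) := by
  have : NeZero m := ⟨hm⟩
  rw [← cycleGreen_neg, neg_sub, sub_eq_neg_add, cycleGreen_add_one, ZMod.val_neg_of_ne_zero,
    Nat.cast_sub (ZMod.val_lt m).le, ← Real.cosh_neg]
  ring_nf

/-- `cycleGreen` is the Green's function of `d ^ 2 * n ^ 2 * L - 1`. -/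
lemma cycleGreen_eq {d : ℝ} (hd : 0 < d) {n : ℕ} [NeZero n] (m : ZMod n) :
    d ^ 2 * (n : ℝ) ^ 2 * cycleLaplacian (cycleGreen d) m - cycleGreen d m
      + (if m = 0 then 1 else 0) = 0 := by
  have hn : (0 : ℝ) < n := Nat.cast_pos.2 (NeZero.pos n)
  have hrate := cycleGreenRate_eq hd n
  have ha := cycleGreenRate_pos hd n
  unfold cycleLaplacian
  split_ifs with h
  · subst h
    have h1 : 0 < Real.sinh (cycleGreenRate d n) := Real.sinh_pos_iff.2 ha
    have h2 : 0 < Real.sinh (cycleGreenRate d n * n / 2) := Real.sinh_pos_iff.2 (by positivity)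
    have hamp : cycleGreenAmp d n * (2 * (d ^ 2 * (n : ℝ) ^ 2) * Real.sinh (cycleGreenRate d n) *
        Real.sinh (cycleGreenRate d n * n / 2)) = 1 := by
      unfold cycleGreenAmp
      field_simp
    have hs : cycleGreen d (0 - 1 : ZMod n) = cycleGreen d (0 + 1 : ZMod n) := by
      rw [← cycleGreen_neg, neg_sub, sub_zero, zero_add]
    rw [hs, cycleGreen_add_one, cycleGreen, ZMod.val_zero]
    have e1 : cycleGreenRate d n * (((0 : ℕ) : ℝ) + 1 - n / 2)
        = cycleGreenRate d n - cycleGreenRate d n * n / 2 := by push_cast; ring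
    have e2 : cycleGreenRate d n * (((0 : ℕ) : ℝ) - n / 2)
        = -(cycleGreenRate d n * n / 2) := by push_cast; ring
    rw [e1, e2, Real.cosh_sub, Real.cosh_neg]
    -- The addition formula leaves a `sinh * sinh` term, which the amplitude normalises to the unit
    -- source.
    linear_combination -hamp + cycleGreenAmp d n * Real.cosh (cycleGreenRate d n * n / 2) * hrate
  · rw [cycleGreen_add_one, cycleGreen_sub_one d h, cycleGreen]
    have e1 : cycleGreenRate d n * ((m.val : ℝ) + 1 - n / 2)
        = cycleGreenRate d n * (m.val - n / 2) + cycleGreenRate d n := by ring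
    have e2 : cycleGreenRate d n * ((m.val : ℝ) - 1 - n / 2)
        = cycleGreenRate d n * (m.val - n / 2) - cycleGreenRate d n := by ring
    rw [e1, e2, Real.cosh_sub, Real.cosh_add]
    linear_combination cycleGreenAmp d n * Real.cosh (cycleGreenRate d n * (m.val - n / 2)) * hrate

/-! ### Uniqueness and representation of solutions -/

/-- Maximum principle: where `‖f‖` is largest, $(1+2D)\|f\|\le 2D\|f\|$. -/
lemma eq_zero_of_cycleLaplacian_eq {n : ℕ} [NeZero n] {D : ℝ} (hD : 0 ≤ D) {f : ZMod n → ℂ}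
    (hf : ∀ i, (D : ℂ) * cycleLaplacian f i - f i = 0) : f = 0 := by
  obtain ⟨i, hi⟩ := Finite.exists_max fun i => ‖f i‖
  have h1 : ((1 + 2 * D : ℝ) : ℂ) * f i = (D : ℂ) * (f (i + 1) + f (i - 1)) := by
    have := hf i
    unfold cycleLaplacian at this
    push_cast
    linear_combination -this
  have h2 : (1 + 2 * D) * ‖f i‖ ≤ D * (‖f i‖ + ‖f i‖) := by
    calc (1 + 2 * D) * ‖f i‖ = ‖((1 + 2 * D : ℝ) : ℂ) * f i‖ := by
          rw [norm_mul, Complex.norm_real, Real.norm_of_nonneg (by positivity)]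
      _ = D * ‖f (i + 1) + f (i - 1)‖ := by
          rw [h1, norm_mul, Complex.norm_real, Real.norm_of_nonneg hD]
      _ ≤ D * (‖f i‖ + ‖f i‖) :=
          mul_le_mul_of_nonneg_left ((norm_add_le _ _).trans (add_le_add (hi _) (hi _))) hD
  funext j
  exact norm_le_zero_iff.1 ((hi j).trans (by linarith))

lemma cycleLaplacian_sum_cycleGreen {d : ℝ} (hd : 0 < d) {n : ℕ} [NeZero n] {ι : Type*} [Fintype ι]
    {p : ι → ZMod n} (b : ι → ℂ) (i : ZMod n) :
    ((d ^ 2 * (n : ℝ) ^ 2 : ℝ) : ℂ) *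
        cycleLaplacian (fun i => ∑ k, b k * (cycleGreen d (i - p k) : ℂ)) i
      - ∑ k, b k * (cycleGreen d (i - p k) : ℂ) + ∑ k, (if i = p k then b k else 0) = 0 := by
  simp only [cycleLaplacian, ← Finset.sum_sub_distrib, ← Finset.sum_add_distrib, Finset.mul_sum]
  refine Finset.sum_eq_zero fun k _ => ?_
  have h := congrArg (fun r : ℝ => (r : ℂ)) (cycleGreen_eq hd (i - p k))
  simp only [cycleLaplacian, sub_eq_zero (a := i)] at h
  rw [show i + 1 - p k = i - p k + 1 by ring, show i - 1 - p k = i - p k - 1 by ring]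
  split_ifs at h ⊢ with hik <;> push_cast at h ⊢ <;> linear_combination b k * h

/-- The solution of `d ^ 2 * n ^ 2 * L f - f + w = 0` with `w` supported on finitely many nodes. -/
lemma eq_sum_cycleGreen {d : ℝ} (hd : 0 < d) {n : ℕ} [NeZero n] {ι : Type*} [Fintype ι]
    {p : ι → ZMod n} (hp : Function.Injective p) {f w : ZMod n → ℂ}
    (hw : ∀ i, i ∉ Set.range p → w i = 0)
    (hf : ∀ i, ((d ^ 2 * (n : ℝ) ^ 2 : ℝ) : ℂ) * cycleLaplacian f i - f i + w i = 0)
    (i : ZMod n) : f i = ∑ k, w (p k) * (cycleGreen d (i - p k) : ℂ) := by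
  classical
  have hsum : ∀ i, ∑ k, (if i = p k then w (p k) else 0) = w i := by
    intro i
    by_cases hi : i ∈ Set.range p
    · obtain ⟨k, rfl⟩ := hi
      rw [Finset.sum_eq_single k] <;> simp +contextual [hp.eq_iff, eq_comm]
    · rw [hw i hi]
      exact Finset.sum_eq_zero fun k _ => if_neg fun h => hi ⟨k, h.symm⟩
  have h0 := eq_zero_of_cycleLaplacian_eq (n := n) (D := d ^ 2 * (n : ℝ) ^ 2) (by positivity)
    (f := fun i => f i - ∑ k, w (p k) * (cycleGreen d (i - p k) : ℂ)) (by
      intro i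
      have h1 := cycleLaplacian_sum_cycleGreen hd (p := p) (fun k => w (p k)) i
      have h2 := hf i
      rw [hsum] at h1
      simp only [cycleLaplacian] at h1 h2 ⊢
      linear_combination h2 - h1)
  exact sub_eq_zero.1 (congrFun h0 i)

/-! ### Continuum limit of the Green's function -/

/-- The sequence is `1 / d` times a difference quotient of `arsinh` at `0`, where the derivative is
`1`. -/
lemma tendsto_mul_cycleGreenRate {d : ℝ} (hd : 0 < d) :
    Tendsto (fun n : ℕ => n * cycleGreenRate d n) atTop (𝓝 (1 / d)) := by
  have h1 := (hasDerivAt_iff_tendsto_slope_zero.1 (Real.hasDerivAt_arsinh 0))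
  have h2 : Tendsto (fun n : ℕ => 1 / (2 * d * (n : ℝ))) atTop (𝓝[≠] 0) := by
    refine tendsto_nhdsWithin_iff.2 ⟨?_, ?_⟩
    · simp only [one_div]
      exact (tendsto_natCast_atTop_atTop.const_mul_atTop (by positivity)).inv_tendsto_atTop
    · filter_upwards [eventually_gt_atTop 0] with n hn
      have : (0 : ℝ) < n := Nat.cast_pos.2 hn
      simp only [Set.mem_compl_iff, Set.mem_singleton_iff]
      positivity
  have h3 := (h1.comp h2).const_mul (1 / d)
  simp only [Real.arsinh_zero, zero_add, sub_zero, smul_eq_mul] at h3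
  simp only [ne_eq, OfNat.ofNat_ne_zero, not_false_eq_true, zero_pow, add_zero, Real.sqrt_one,
    inv_one, mul_one] at h3
  refine h3.congr fun n => ?_
  simp only [Function.comp, cycleGreenRate]
  field_simp

lemma tendsto_cycleGreenRate {d : ℝ} (hd : 0 < d) :
    Tendsto (fun n : ℕ => cycleGreenRate d n) atTop (𝓝 0) := by
  have h := (tendsto_mul_cycleGreenRate hd).mul tendsto_inv_atTop_nhds_zero_nat
  rw [mul_zero] at h
  refine h.congr' ?_
  filter_upwards [eventually_gt_atTop 0] with n hn
  have : (0 : ℝ) < n := Nat.cast_pos.2 hn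
  field_simp

/-- With $a$ the rate, $\sinh(a/2)=1/(2dn)$ and the double-angle formula cancel all explicit powers
of `n`. -/
lemma tendsto_mul_cycleGreenAmp {d : ℝ} (hd : 0 < d) :
    Tendsto (fun n : ℕ => n * cycleGreenAmp d n) atTop
      (𝓝 (1 / (2 * d * Real.sinh (1 / (2 * d))))) := by
  have h1 : Tendsto (fun n : ℕ => 1 / (2 * d * Real.cosh (cycleGreenRate d n / 2) *
      Real.sinh (n * cycleGreenRate d n / 2))) atTop
      (𝓝 (1 / (2 * d * Real.cosh (0 / 2) * Real.sinh (1 / d / 2)))) := by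
    have hs : 0 < Real.sinh (1 / d / 2) := Real.sinh_pos_iff.2 (by positivity)
    have hc := Real.cosh_pos (0 / 2)
    refine Tendsto.div tendsto_const_nhds (Tendsto.mul (Tendsto.mul tendsto_const_nhds ?_) ?_)
      (by positivity)
    · exact (Real.continuous_cosh.tendsto _).comp ((tendsto_cycleGreenRate hd).div_const 2)
    · exact (Real.continuous_sinh.tendsto _).comp ((tendsto_mul_cycleGreenRate hd).div_const 2)
  rw [zero_div, Real.cosh_zero, mul_one, div_div 1 d 2, mul_comm d 2] at h1
  refine h1.congr' ?_
  filter_upwards [eventually_gt_atTop 0] with n hn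
  have hn' : (0 : ℝ) < n := Nat.cast_pos.2 hn
  have : NeZero n := ⟨hn.ne'⟩
  have ha := cycleGreenRate_pos hd n
  have h2 : 0 < Real.sinh (n * cycleGreenRate d n / 2) := Real.sinh_pos_iff.2 (by positivity)
  have hc := Real.cosh_pos (cycleGreenRate d n / 2)
  have hs : Real.sinh (cycleGreenRate d n / 2) = 1 / (2 * d * n) := by
    rw [cycleGreenRate, mul_div_cancel_left₀ _ two_ne_zero, Real.sinh_arsinh]
  have h3 : Real.sinh (cycleGreenRate d n) =
      2 * (1 / (2 * d * n)) * Real.cosh (cycleGreenRate d n / 2) := by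
    rw [← hs, ← Real.sinh_two_mul, mul_div_cancel₀ _ two_ne_zero]
  rw [cycleGreenAmp, h3, mul_comm (cycleGreenRate d n) (n : ℝ)]
  field_simp

lemma mul_cycleGreen_eq (d : ℝ) {n : ℕ} [NeZero n] (m : ZMod n) :
    n * cycleGreen d m = n * cycleGreenAmp d n *
      Real.cosh (n * cycleGreenRate d n * (‖ZMod.toAddCircle m‖ - 1 / 2)) := by
  have hn : (0 : ℝ) < n := Nat.cast_pos.2 (NeZero.pos n)
  have hlt := ZMod.val_lt m
  have hnorm : ‖ZMod.toAddCircle m‖ = ((min m.val (n - m.val) : ℕ) : ℝ) / n := by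
    have := AddCircle.norm_div_natCast (p := (1 : ℝ)) (m := m.val) (n := n)
    rw [mul_one, one_mul, Nat.mod_eq_of_lt hlt] at this
    rw [ZMod.toAddCircle_apply]
    exact this
  rw [hnorm, cycleGreen, mul_assoc]
  congr 2
  rcases le_total m.val (n - m.val) with h | h
  · rw [min_eq_left h]
    congr 1
    field_simp
  · rw [min_eq_right h, Nat.cast_sub hlt.le, ← Real.cosh_neg]
    congr 1
    field_simp
    ring

/-- The rescaled discrete Green's function converges uniformly to the periodic one. -/
lemma exists_abs_mul_cycleGreen_sub_le {d : ℝ} (hd : 0 < d) {ρ : ℝ} (hρ : 0 < ρ) :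
    ∃ δ : ℝ, 0 < δ ∧ ∃ N : ℕ, ∀ (n : ℕ) [NeZero n], N ≤ n → ∀ (m : ZMod n) (x y : UnitAddCircle),
      ‖ZMod.toAddCircle m - (x - y)‖ ≤ δ → |n * cycleGreen d m - Gper d x y| < ρ := by
  set c := 1 / (2 * d * Real.sinh (1 / (2 * d))) with hc
  let f : (ℝ × ℝ) × ℝ → ℝ := fun q => q.1.1 * Real.cosh (q.1.2 * (q.2 - 1 / 2))
  -- Both kernels are values of `f`, with only the parameters differing. Arc distances stay in a
  -- compact set, so uniform continuity makes the convergence uniform in the nodes.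
  have hfc : Continuous f := by fun_prop
  have hK : IsCompact (Metric.closedBall (((c, 1 / d), 0) : (ℝ × ℝ) × ℝ) 1) :=
    isCompact_closedBall _ _
  obtain ⟨δ, hδ, hu⟩ := Metric.uniformContinuousOn_iff.1
    (hK.uniformContinuousOn_of_continuous hfc.continuousOn) ρ hρ
  have hlim := Metric.tendsto_atTop.1
    ((tendsto_mul_cycleGreenAmp hd).prodMk_nhds (tendsto_mul_cycleGreenRate hd)) (min δ 1)
    (by positivity)
  obtain ⟨N, hN⟩ := hlim
  refine ⟨δ / 2, by positivity, N, fun n _ hn m x y hm => ?_⟩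
  have hG : Gper d x y = f ((c, 1 / d), ‖x - y‖) := by
    simp only [Gper, f, hc]
    rw [div_eq_mul_one_div, mul_comm]
    ring_nf
  have hcirc : ∀ z : UnitAddCircle, |‖z‖| ≤ 1 := fun z => by
    rw [abs_norm]
    have := AddCircle.norm_le_half_period (p := (1 : ℝ)) (x := z) one_ne_zero
    rw [abs_one] at this
    linarith
  rw [mul_cycleGreen_eq, hG, ← Real.dist_eq]
  have hNn := hN n hn
  refine hu ((n * cycleGreenAmp d n, n * cycleGreenRate d n), ‖ZMod.toAddCircle m‖) ?_ _ ?_ ?_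
  · rw [Metric.mem_closedBall, Prod.dist_eq]
    refine max_le (hNn.le.trans (min_le_right _ _)) ?_
    simpa using hcirc (ZMod.toAddCircle m)
  · rw [Metric.mem_closedBall, Prod.dist_eq]
    refine max_le (by simp) ?_
    simpa using hcirc (x - y)
  · rw [Prod.dist_eq]
    refine max_lt (hNn.trans_le (min_le_left _ _)) ?_
    rw [Real.dist_eq]
    exact ((abs_norm_sub_norm_le _ _).trans hm).trans_lt (by linarith)

lemma Gper_lower_pos {d : ℝ} (hd : 0 < d) : 0 < 1 / (2 * d * Real.sinh (1 / (2 * d))) := by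
  have : 0 < Real.sinh (1 / (2 * d)) := Real.sinh_pos_iff.2 (by positivity)
  positivity

/-- This turns uniform absolute errors into relative ones. -/
lemma Gper_lower {d : ℝ} (hd : 0 < d) (x y : UnitAddCircle) :
    1 / (2 * d * Real.sinh (1 / (2 * d))) ≤ Gper d x y := by
  have : 0 < Real.sinh (1 / (2 * d)) := Real.sinh_pos_iff.2 (by positivity)
  unfold Gper
  gcongr
  exact Real.one_le_cosh _

lemma Gper_comm (d : ℝ) (x y : UnitAddCircle) : Gper d x y = Gper d y x := by
  rw [Gper, Gper, norm_sub_rev]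

/-! ### Perturbation of the reduced system -/

/-- The reduced system `ξ k = ∑ j, ξ j ^ 2 * Γ k j` stays solvable near a solution at which the
linearisation is invertible. -/
lemma eventually_exists_reduced {K : ℕ} {V : Fin K → ℝ} {G : Fin K → Fin K → ℝ}
    (hV : ∀ k, V k = ∑ j, V j ^ 2 * G k j)
    (hU : IsUnit (1 - Matrix.of fun k j => 2 * V j * G k j)) {U : Set (Fin K → ℝ)}
    (hUV : U ∈ 𝓝 V) :
    ∀ᶠ Γ in 𝓝 G, ∃ ξ ∈ U, ∀ k, ξ k = ∑ j, ξ j ^ 2 * Γ k j := by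
  -- Carrying the coefficients along as a second component makes the inverse function theorem act as
  -- an implicit one.
  let Φ : (Fin K → ℝ) × (Fin K → Fin K → ℝ) → (Fin K → ℝ) × (Fin K → Fin K → ℝ) :=
    fun q => (fun k => q.1 k - ∑ j, q.1 j ^ 2 * q.2 k j, q.2)
  have hΦ : ContDiff ℝ 1 Φ := by fun_prop
  have hd : HasStrictFDerivAt Φ (fderiv ℝ Φ (V, G)) (V, G) :=
    hΦ.contDiffAt.hasStrictFDerivAt one_ne_zero
  have hval : ∀ (h : Fin K → ℝ) (H : Fin K → Fin K → ℝ), fderiv ℝ Φ (V, G) (h, H) =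
      (fun k => h k - ∑ j, (2 * V j * h j * G k j + V j ^ 2 * H k j), H) := by
    intro h H
    have hline : HasDerivAt (fun t : ℝ => (V, G) + t • (h, H)) (h, H) 0 := by
      simpa using ((hasDerivAt_id (0 : ℝ)).smul_const (h, H)).const_add (V, G)
    have h1 : HasDerivAt (fun t : ℝ => Φ ((V, G) + t • (h, H)))
        (fderiv ℝ Φ (V, G) (h, H)) 0 := by
      have hd' : HasFDerivAt Φ (fderiv ℝ Φ (V, G)) ((V, G) + (0 : ℝ) • (h, H)) := by
        simpa using hd.hasFDerivAt
      exact hd'.comp_hasDerivAt (0 : ℝ) hline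
    refine h1.unique (HasDerivAt.prodMk (hasDerivAt_pi.2 fun k => ?_) ?_)
    · have hc : ∀ a b : ℝ, HasDerivAt (fun t : ℝ => a + t * b) b 0 := fun a b => by
        simpa using ((hasDerivAt_id (0 : ℝ)).mul_const b).const_add a
      have := (hc (V k) (h k)).fun_sub (HasDerivAt.fun_sum (u := Finset.univ) fun j _ =>
        ((hc (V j) (h j)).pow 2).mul (hc (G k j) (H k j)))
      simpa using this
    · simpa using ((hasDerivAt_id (0 : ℝ)).smul_const H).const_add G
  have hsurj : (fderiv ℝ Φ (V, G)).range = ⊤ := by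
    refine LinearMap.range_eq_top.2 fun ⟨a, B⟩ => ?_
    -- The coefficient direction `B` is prescribed, so only a linear system with matrix $I-M$
    -- remains.
    obtain ⟨h, hh⟩ := (Matrix.mulVec_surjective_iff_isUnit.2 hU)
      (fun k => a k + ∑ j, V j ^ 2 * B k j)
    refine ⟨(h, B), ?_⟩
    refine (hval h B).trans (Prod.ext (funext fun k => ?_) rfl)
    have := congrFun hh k
    rw [Matrix.sub_mulVec, Matrix.one_mulVec] at this
    simp only [Pi.sub_apply, Matrix.mulVec, dotProduct, Matrix.of_apply] at this
    simp only [Finset.sum_add_distrib]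
    rw [Finset.sum_congr rfl fun j _ => (by ring : 2 * V j * h j * G k j = 2 * V j * G k j * h j)]
    linear_combination this
  have hmap := hd.map_nhds_eq_of_surj hsurj
  have h0 : Φ (V, G) = (0, G) := Prod.ext (funext fun k => sub_eq_zero.2 (hV k)) rfl
  have hmem : Φ '' (U ×ˢ Set.univ) ∈ 𝓝 ((0 : Fin K → ℝ), G) := by
    rw [← h0, ← hmap]
    exact image_mem_map (prod_mem_nhds hUV univ_mem)
  have ht : Tendsto (fun Γ : Fin K → Fin K → ℝ => ((0 : Fin K → ℝ), Γ)) (𝓝 G) (𝓝 ((0 : Fin K → ℝ), G)) :=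
    (Continuous.prodMk_right (0 : Fin K → ℝ)).tendsto G
  filter_upwards [ht hmem] with Γ hΓ
  obtain ⟨⟨ξ, Γ'⟩, hq, he⟩ := hΓ
  obtain ⟨h1, rfl⟩ := Prod.ext_iff.1 he
  exact ⟨ξ, hq.1, fun k => sub_eq_zero.1 (congrFun h1 k)⟩

/-! ### Spectra of the reduced matrices -/

section
attribute [local instance] Matrix.linftyOpNormedRing Matrix.linftyOpNormedAlgebra

lemma eventually_spectrum_subset {ι : Type*} [Fintype ι] [DecidableEq ι] {A : Matrix ι ι ℂ}
    {s : Set ℂ} (hs : IsOpen s) (hA : spectrum ℂ A ⊆ s) : ∀ᶠ B in 𝓝 A, spectrum ℂ B ⊆ s := by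
  have h := upperHemicontinuous_spectrum ℂ (Matrix ι ι ℂ)
  have := upperHemicontinuousAt_iff.1 (h.upperHemicontinuousAt A) s (hs.mem_nhdsSet.2 hA)
  filter_upwards [this] with B hB
  exact subset_of_mem_nhdsSet hB

end

lemma mem_spectrum_iff_exists_mulVec {ι : Type*} [Fintype ι] [DecidableEq ι] {A : Matrix ι ι ℂ}
    {z : ℂ} : z ∈ spectrum ℂ A ↔ ∃ φ ≠ 0, A.mulVec φ = z • φ := by
  rw [spectrum.mem_iff, Matrix.isUnit_iff_isUnit_det, isUnit_iff_ne_zero, not_not,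
    ← Matrix.exists_mulVec_eq_zero_iff]
  refine exists_congr fun φ => and_congr_right fun _ => ?_
  rw [Matrix.sub_mulVec, sub_eq_zero, Algebra.algebraMap_eq_smul_one, Matrix.smul_mulVec,
    Matrix.one_mulVec, eq_comm]

/-- `1 - G * diag w` has real spectrum if `G` is symmetric and `w` is positive. -/
lemma im_eq_zero_of_mem_spectrum {ι : Type*} [Fintype ι] [DecidableEq ι] {G : ι → ι → ℝ}
    (hG : ∀ k j, G k j = G j k) {w : ι → ℝ} (hw : ∀ k, 0 < w k) {z : ℂ}
    (hz : z ∈ spectrum ℂ ((1 - Matrix.of fun k j => w j * G k j).map (algebraMap ℝ ℂ))) :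
    z.im = 0 := by
  obtain ⟨φ, hφ, h⟩ := mem_spectrum_iff_exists_mulVec.1 hz
  have hk : ∀ k, ∑ j, ((w j * G k j : ℝ) : ℂ) * φ j = (1 - z) * φ k := by
    intro k
    have := congrFun h k
    rw [Matrix.map_sub _ (by simp), Matrix.map_one _ (by simp) (by simp), Matrix.sub_mulVec,
      Matrix.one_mulVec] at this
    simp only [Pi.sub_apply, Matrix.mulVec, dotProduct, Matrix.map_apply, Matrix.of_apply,
      Complex.coe_algebraMap, Pi.smul_apply, smul_eq_mul] at this
    linear_combination -this
  -- The Hermitian form of `diag w * G * diag w` is real; on an eigenvector it equals $(1-z)\sum_k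
  -- w_k|\varphi_k|^2$.
  set S : ℂ := ∑ k, ∑ j, ((w k * w j * G k j : ℝ) : ℂ) * (star (φ k) * φ j) with hS
  have hstar : star S = S := by
    rw [hS]
    simp only [star_sum, star_mul', star_star]
    rw [Finset.sum_comm]
    refine Finset.sum_congr rfl fun k _ => Finset.sum_congr rfl fun j _ => ?_
    rw [Complex.star_def, Complex.conj_ofReal, hG j k, mul_comm (w j)]
    ring
  have hS2 : S = (1 - z) * ((∑ k, w k * ‖φ k‖ ^ 2 : ℝ) : ℂ) := by
    rw [hS]
    push_cast
    rw [Finset.mul_sum]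
    refine Finset.sum_congr rfl fun k _ => ?_
    have h2 : (star (φ k)) * φ k = (‖φ k‖ : ℂ) ^ 2 := by
      rw [Complex.star_def, Complex.conj_mul']
    rw [← h2]
    calc _ = (w k : ℂ) * star (φ k) * ∑ j, ((w j * G k j : ℝ) : ℂ) * φ j := by
          rw [Finset.mul_sum]
          refine Finset.sum_congr rfl fun j _ => ?_
          push_cast
          ring
      _ = _ := by rw [hk]; ring
  have hpos : 0 < ∑ k, w k * ‖φ k‖ ^ 2 := by
    obtain ⟨k, hk⟩ := Function.ne_iff.1 hφ
    exact Finset.sum_pos' (fun k _ => mul_nonneg (hw k).le (by positivity))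
      ⟨k, Finset.mem_univ _, mul_pos (hw k) (pow_pos (norm_pos_iff.2 hk) 2)⟩
  have him := congrArg Complex.im hS2
  rw [Complex.im_mul_ofReal, Complex.conj_eq_iff_im.1 hstar] at him
  have := (mul_eq_zero.1 him.symm).resolve_right hpos.ne'
  simpa using this

/-! ### Reduction of the full problem to the spike nodes -/

/-- The eigenvalues of the linearisation at a spike state. -/
lemma IsGrowthRate.eq_or_mem_spectrum {K n : ℕ} [NeZero n] {d : ℝ} (hd : 0 < d)
    {p : Fin K → ZMod n} (hp : Function.Injective p) {u v : ZMod n → ℝ}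
    (hst : IsSteadyState 0 (d ^ 2 * (n : ℝ) ^ 2) u v) (hoff : ∀ i, i ∉ Set.range p → u i = 0)
    (hu : ∀ k, u (p k) ≠ 0) {z : ℂ} (hz : IsGrowthRate 0 (d ^ 2 * (n : ℝ) ^ 2) 0 u v z) :
    z = -1 ∨ z ∈ spectrum ℂ ((1 - Matrix.of fun k j =>
      2 * (u (p j) / n) * (n * cycleGreen d (p k - p j))).map (algebraMap ℝ ℂ)) := by
  have hn : (n : ℂ) ≠ 0 := Nat.cast_ne_zero.2 (NeZero.ne n)
  obtain ⟨φ, ψ, hne, h1, h2⟩ := hz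
  refine or_iff_not_imp_left.2 fun hz1 => ?_
  have hz1' : z + 1 ≠ 0 := fun h => hz1 (eq_neg_of_add_eq_zero_left h)
  have hφoff : ∀ i, i ∉ Set.range p → φ i = 0 := by
    intro i hi
    have := h1 i
    simp only [hoff i hi] at this
    have h3 : (z + 1) * φ i = 0 := by
      simp at this
      linear_combination this
    exact (mul_eq_zero.1 h3).resolve_left hz1'
  have hψ : ∀ i, ψ i = ∑ k, 2 * (u (p k) : ℂ) * φ (p k) * (cycleGreen d (i - p k) : ℂ) :=
    eq_sum_cycleGreen hd hp (w := fun i => 2 * (u i : ℂ) * φ i)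
      (fun i hi => by simp [hφoff i hi]) (fun i => by simpa using (h2 i).symm)
  have huv : ∀ k, u (p k) / v (p k) = 1 := by
    intro k
    have h3 := hst.eq_u (p k)
    have hv := (hst.pos (p k)).ne'
    have h4 : u (p k) * (u (p k) / v (p k) - 1) = 0 := by
      rw [zero_mul, zero_sub] at h3
      linear_combination h3
    linarith [(mul_eq_zero.1 h4).resolve_left (hu k)]
  -- The restriction of `φ` to the spikes is a nonzero eigenvector, because it determines `φ` and,
  -- through the Green's function, `ψ`.
  refine mem_spectrum_iff_exists_mulVec.2 ⟨fun k => φ (p k), fun h0 => ?_, funext fun k => ?_⟩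
  · have hφ0 : φ = 0 := by
      funext i
      by_cases hi : i ∈ Set.range p
      · obtain ⟨k, rfl⟩ := hi
        exact congrFun h0 k
      · exact hφoff i hi
    have hψ0 : ψ = 0 := by
      funext i
      simp [hψ i, hφ0]
    tauto
  · rw [Matrix.map_sub _ (by simp), Matrix.map_one _ (by simp) (by simp), Matrix.sub_mulVec,
      Matrix.one_mulVec]
    simp only [Pi.sub_apply, Matrix.mulVec, dotProduct, Matrix.map_apply, Matrix.of_apply,
      Complex.coe_algebraMap, Pi.smul_apply, smul_eq_mul]
    have h3 := h1 (p k)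
    rw [← div_pow, huv, hψ] at h3
    simp only [Complex.ofReal_zero, zero_mul, one_pow, Complex.ofReal_one, one_mul, zero_sub,
      mul_one] at h3
    rw [h3]
    have h4 : ∑ j, ((2 * (u (p j) / n) * (n * cycleGreen d (p k - p j)) : ℝ) : ℂ) * φ (p j) =
        ∑ j, 2 * (u (p j) : ℂ) * φ (p j) * (cycleGreen d (p k - p j) : ℂ) := by
      refine Finset.sum_congr rfl fun j _ => ?_
      push_cast
      field_simp
    rw [h4]
    ring

/-- Nodes near distinct points are distinct, and the rescaled discrete interaction coefficients are
near the continuous ones. -/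
lemma exists_forall_nodesNear {K : ℕ} {d : ℝ} (hd : 0 < d) {x : Fin K → UnitAddCircle}
    (hx : Function.Injective x) {ρ : ℝ} (hρ : 0 < ρ) :
    ∃ δ : ℝ, 0 < δ ∧ ∃ N : ℕ, ∀ (n : ℕ) [NeZero n], N ≤ n → ∀ p : Fin K → ZMod n,
      NodesNear δ x p → Function.Injective p ∧
        (∀ i k, |n * cycleGreen d (i - p k) - Gper d (ZMod.toAddCircle i) (x k)| < ρ) ∧
        ∀ k j, |n * cycleGreen d (p k - p j) - Gper d (x k) (x j)| < ρ := by
  obtain ⟨δ₁, hδ₁, N, hN⟩ := exists_abs_mul_cycleGreen_sub_le hd hρ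
  -- Below half the least separation of the `x k`, two spikes cannot share a node.
  obtain ⟨δ₂, hδ₂, hsep⟩ : ∃ δ₂ : ℝ, 0 < δ₂ ∧ ∀ k j, k ≠ j → 2 * δ₂ < ‖x k - x j‖ := by
    have : ∀ᶠ δ in 𝓝[>] (0 : ℝ), ∀ k j, k ≠ j → 2 * δ < ‖x k - x j‖ := by
      refine eventually_all.2 fun k => eventually_all.2 fun j => ?_
      by_cases hkj : k = j
      · simp [hkj]
      · have hpos : 0 < ‖x k - x j‖ := norm_pos_iff.2 (sub_ne_zero.2 (hx.ne hkj))
        filter_upwards [Ioo_mem_nhdsGT (half_pos hpos)] with δ hδ _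
        linarith [hδ.2]
    obtain ⟨δ, h1, h2⟩ := (this.and self_mem_nhdsWithin).exists
    exact ⟨δ, h2, h1⟩
  refine ⟨min (δ₁ / 2) δ₂, by positivity, N, fun n _ hn p hp => ⟨?_, ?_, ?_⟩⟩
  · intro k j hkj
    by_contra hne
    have h1 := (hp k).trans (min_le_right _ _)
    have h2 := (hp j).trans (min_le_right _ _)
    rw [hkj] at h1
    have h3 : x k - x j = (ZMod.toAddCircle (p j) - x j) - (ZMod.toAddCircle (p j) - x k) := by abel
    have h4 := norm_sub_le (ZMod.toAddCircle (p j) - x j) (ZMod.toAddCircle (p j) - x k)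
    rw [← h3] at h4
    linarith [hsep k j hne]
  · intro i k
    refine hN n hn _ _ _ ?_
    have h1 := (hp k).trans (min_le_left _ _)
    rw [map_sub, sub_sub_sub_cancel_left, norm_sub_rev]
    linarith
  · intro k j
    refine hN n hn _ _ _ ?_
    have h1 := (hp k).trans (min_le_left _ _)
    have h2 := (hp j).trans (min_le_left _ _)
    rw [map_sub, sub_sub_sub_comm]
    exact (norm_sub_le _ _).trans (by linarith)

/-- The steady state generated by a solution of the discrete reduced system. -/
lemma exists_isSteadyState {K n : ℕ} [NeZero n] (hK : 0 < K) {d : ℝ} (hd : 0 < d)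
    {p : Fin K → ZMod n} (hp : Function.Injective p) {ξ : Fin K → ℝ} (hξ : ∀ k, 0 < ξ k)
    (h : ∀ k, ξ k = ∑ j, ξ j ^ 2 * (n * cycleGreen d (p k - p j))) :
    ∃ u v : ZMod n → ℝ, IsSteadyState 0 (d ^ 2 * (n : ℝ) ^ 2) u v ∧
      (∀ i, i ∉ Set.range p → u i = 0) ∧ (∀ k, u (p k) = n * ξ k) ∧
      ∀ i, v i = ∑ k, n * ξ k ^ 2 * (n * cycleGreen d (i - p k)) := by
  have hn : (0 : ℝ) < n := Nat.cast_pos.2 (NeZero.pos n)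
  set u : ZMod n → ℝ := Function.extend p (fun k => n * ξ k) 0 with hu
  have hup : ∀ k, u (p k) = n * ξ k := fun k => hp.extend_apply _ _ k
  have hoff : ∀ i, i ∉ Set.range p → u i = 0 := fun i hi => Function.extend_apply' _ _ _ hi
  set v : ZMod n → ℝ := fun i => ∑ k, n * ξ k ^ 2 * (n * cycleGreen d (i - p k)) with hv
  -- The reduced system says exactly that `u = v` at the spikes.
  have hvp : ∀ k, v (p k) = n * ξ k := by
    intro k
    rw [h k, Finset.mul_sum]
    exact Finset.sum_congr rfl fun j _ => by ring
  refine ⟨u, v, ⟨fun i => ?_, fun i => ?_, fun i => ?_⟩, hoff, hup, fun i => rfl⟩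
  · have : Nonempty (Fin K) := ⟨⟨0, hK⟩⟩
    refine Finset.sum_pos (fun k _ => ?_) Finset.univ_nonempty
    have := hξ k
    have := cycleGreen_pos hd (i - p k)
    positivity
  · by_cases hi : i ∈ Set.range p
    · obtain ⟨k, rfl⟩ := hi
      have := hξ k
      rw [hvp, hup]
      field_simp
      ring
    · simp [hoff i hi]
  · have hs := cycleLaplacian_sum_cycleGreen hd (p := p) (fun k => (((n * ξ k) ^ 2 : ℝ) : ℂ)) i
    have hu2 : ∑ k, (if i = p k then (((n * ξ k) ^ 2 : ℝ) : ℂ) else 0) = ((u i ^ 2 : ℝ) : ℂ) := by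
      by_cases hi : i ∈ Set.range p
      · obtain ⟨k, rfl⟩ := hi
        rw [Finset.sum_eq_single k, if_pos rfl, hup]
        · exact fun j _ hj => if_neg fun h => hj (hp h).symm
        · simp
      · rw [hoff i hi]
        rw [zero_pow two_ne_zero, Complex.ofReal_zero]
        exact Finset.sum_eq_zero fun k _ => if_neg fun h => hi ⟨k, h.symm⟩
    have hvc : ∀ i, ∑ k, (((n * ξ k) ^ 2 : ℝ) : ℂ) * (cycleGreen d (i - p k) : ℂ) = (v i : ℂ) := by
      intro i
      rw [hv]
      push_cast
      exact Finset.sum_congr rfl fun k _ => by ring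
    rw [hu2] at hs
    simp only [hvc, cycleLaplacian] at hs ⊢
    exact_mod_cast hs

/-! ### Existence and stability -/

/-- Existence of spike states. -/
lemma exists_spikeState {K : ℕ} (hK : 0 < K) {d : ℝ} (hd : 0 < d)
    {x : Fin K → UnitAddCircle} (hx : Function.Injective x)
    {V : Fin K → ℝ} (hV : ∀ k, 0 < V k)
    (hsys : ∀ k, V k = ∑ j, V j ^ 2 * Gper d (x k) (x j))
    (hU : IsUnit (1 - spikeMatrix d x V)) {ε : ℝ} (hε : 0 < ε) :
    ∃ δ : ℝ, 0 < δ ∧ ∃ N : ℕ, ∀ (n : ℕ) [NeZero n], N ≤ n →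
      ∀ p : Fin K → ZMod n, NodesNear δ x p →
        ∃ u v : ZMod n → ℝ, IsSteadyState 0 (d ^ 2 * (n : ℝ) ^ 2) u v ∧
          HasSpikeProfile ε d x V p u v := by
  -- The bound `τ ≤ 1` gives `g ≤ 2 * G`; then the error in `ξ k ^ 2` costs `2 * τ` and the error in
  -- `g` costs `τ`.
  set τ := min (ε / 3) 1 with hτ
  have hτ0 : 0 < τ := by positivity
  have hτ1 : τ ≤ 1 := min_le_right _ _
  have hτε : 3 * τ ≤ ε := by linarith [min_le_left (ε / 3) 1]
  have hc0 := Gper_lower_pos hd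
  set c₀ := 1 / (2 * d * Real.sinh (1 / (2 * d))) with hc
  have hnear : ∀ᶠ ξ in 𝓝 V, ∀ k, 0 < ξ k ∧ |ξ k - V k| < ε * V k ∧
      |ξ k ^ 2 - V k ^ 2| < τ * V k ^ 2 := by
    refine eventually_all.2 fun k => ?_
    have hVk := hV k
    have hk : Continuous fun ξ : Fin K → ℝ => ξ k := continuous_apply k
    refine (continuousAt_const.eventually_lt hk.continuousAt (hV k)).and
      (ContinuousAt.eventually_lt (hk.sub continuous_const).abs.continuousAt continuousAt_const ?_ |>.and
        (ContinuousAt.eventually_lt ((hk.pow 2).sub continuous_const).abs.continuousAt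
          continuousAt_const ?_)) <;>
    · simp only [Pi.sub_apply, sub_self, abs_zero]
      positivity
  obtain ⟨ρ, hρ, hball⟩ := Metric.eventually_nhds_iff.1
    (eventually_exists_reduced hsys hU hnear)
  obtain ⟨δ, hδ, N, hN⟩ := exists_forall_nodesNear hd hx (ρ := min ρ (τ * c₀)) (by positivity)
  refine ⟨δ, hδ, N, fun n _ hn p hp => ?_⟩
  have hn0 : (0 : ℝ) < n := Nat.cast_pos.2 (NeZero.pos n)
  obtain ⟨hinj, h1, h2⟩ := hN n hn p hp
  obtain ⟨ξ, hξ, hξeq⟩ := hball (y := fun k j => n * cycleGreen d (p k - p j))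
    ((dist_pi_lt_iff hρ).2 fun k => (dist_pi_lt_iff hρ).2 fun j =>
      (h2 k j).trans_le (min_le_left _ _))
  obtain ⟨u, v, hst, hoff, hup, hv⟩ := exists_isSteadyState hK hd hinj (fun k => (hξ k).1) hξeq
  refine ⟨u, v, hst, hoff, fun k => ?_, fun i => ?_⟩
  · rw [hup, ← mul_sub, abs_mul, abs_of_pos hn0]
    calc n * |ξ k - V k| ≤ n * (ε * V k) := by gcongr; exact (hξ k).2.1.le
      _ = ε * (n * V k) := by ring
  · rw [hv, ← Finset.sum_sub_distrib, Finset.mul_sum]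
    refine (Finset.abs_sum_le_sum_abs _ _).trans (Finset.sum_le_sum fun k _ => ?_)
    have hG := (hc0.trans_le (Gper_lower hd (ZMod.toAddCircle i) (x k)))
    have h3 : |n * cycleGreen d (i - p k) - Gper d (ZMod.toAddCircle i) (x k)|
        ≤ τ * Gper d (ZMod.toAddCircle i) (x k) :=
      ((h1 i k).le.trans (min_le_right _ _)).trans
        (mul_le_mul_of_nonneg_left (Gper_lower hd _ _) hτ0.le)
    have h4 := (hξ k).2.2.le
    set g := n * cycleGreen d (i - p k)
    set G := Gper d (ZMod.toAddCircle i) (x k)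
    have hg0 : 0 < g := mul_pos hn0 (cycleGreen_pos hd _)
    clear_value g
    have hg : g ≤ 2 * G := by nlinarith [(abs_le.1 h3).2]
    have e : n * ξ k ^ 2 * g - n * V k ^ 2 * G
        = n * ((ξ k ^ 2 - V k ^ 2) * g + V k ^ 2 * (g - G)) := by ring
    have hVk := hV k
    rw [e, abs_mul, abs_of_pos hn0]
    calc n * |(ξ k ^ 2 - V k ^ 2) * g + V k ^ 2 * (g - G)|
        ≤ n * (|ξ k ^ 2 - V k ^ 2| * g + V k ^ 2 * |g - G|) := by
          refine mul_le_mul_of_nonneg_left ((abs_add_le _ _).trans ?_) hn0.le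
          rw [abs_mul, abs_mul, abs_of_pos hg0, abs_of_nonneg (sq_nonneg (V k))]
      _ ≤ n * (τ * V k ^ 2 * (2 * G) + V k ^ 2 * (τ * G)) := by gcongr
      _ = 3 * τ * (n * V k ^ 2 * G) := by ring
      _ ≤ ε * (n * V k ^ 2 * G) := by gcongr

/-- A spectral bound for `1 - M` carries over to the linearisation at spike states. -/
lemma exists_forall_isGrowthRate_re_lt {K : ℕ} {d : ℝ} (hd : 0 < d)
    {x : Fin K → UnitAddCircle} (hx : Function.Injective x)
    {V : Fin K → ℝ} (hV : ∀ k, 0 < V k) {η : ℝ} (hη : 0 ≤ η)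
    (hspec : ∀ z ∈ spectrum ℂ ((1 - spikeMatrix d x V).map (algebraMap ℝ ℂ)), z.re < η) :
    ∃ ε : ℝ, 0 < ε ∧ ∃ δ : ℝ, 0 < δ ∧ ∃ N : ℕ, ∀ (n : ℕ) [NeZero n], N ≤ n →
      ∀ p : Fin K → ZMod n, NodesNear δ x p →
        ∀ u v : ZMod n → ℝ, IsSteadyState 0 (d ^ 2 * (n : ℝ) ^ 2) u v →
          HasSpikeProfile ε d x V p u v →
            ∀ z : ℂ, IsGrowthRate 0 (d ^ 2 * (n : ℝ) ^ 2) 0 u v z → z.re < η := by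
  let T : (Fin K → ℝ) × (Fin K → Fin K → ℝ) → Matrix (Fin K) (Fin K) ℂ := fun q =>
    (1 - Matrix.of fun k j => 2 * q.1 j * q.2 k j).map (algebraMap ℝ ℂ)
  have hT : Continuous T := by
    refine Continuous.matrix_map (continuous_const.sub ?_) (by exact Complex.continuous_ofReal)
    exact continuous_matrix fun k j => by simp only [Matrix.of_apply]; fun_prop
  have hev := (hT.tendsto (V, fun k j => Gper d (x k) (x j))).eventually
    (eventually_spectrum_subset (isOpen_lt Complex.continuous_re continuous_const) hspec)
  obtain ⟨ρ, hρ, hball⟩ := Metric.eventually_nhds_iff.1 hev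
  -- `ε < 1` keeps `u` nonzero at the spikes; `ε * V k < ρ` keeps the rescaled heights in the ball
  -- of spectral control.
  obtain ⟨ε, ⟨hε1, hεV⟩, hε⟩ : ∃ ε : ℝ, (ε < 1 ∧ ∀ k, ε * V k < ρ) ∧ 0 < ε := by
    have h : ∀ᶠ ε in 𝓝 (0 : ℝ), ε < 1 ∧ ∀ k, ε * V k < ρ := by
      refine (eventually_lt_nhds one_pos).and (eventually_all.2 fun k => ?_)
      exact ContinuousAt.eventually_lt (by fun_prop) continuousAt_const (by simpa using hρ)
    exact ((h.filter_mono nhdsWithin_le_nhds).and (self_mem_nhdsWithin (s := Set.Ioi 0))).exists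
  obtain ⟨δ, hδ, N, hN⟩ := exists_forall_nodesNear hd hx hρ
  refine ⟨ε, hε, δ, hδ, N, fun n _ hn p hp u v hst hprof z hz => ?_⟩
  have hn0 : (0 : ℝ) < n := Nat.cast_pos.2 (NeZero.pos n)
  obtain ⟨hinj, -, h2⟩ := hN n hn p hp
  have hu : ∀ k, u (p k) ≠ 0 := by
    intro k h0
    have h3 := hprof.spike k
    have h4 : 0 < n * V k := mul_pos hn0 (hV k)
    rw [h0, zero_sub, abs_neg, abs_of_pos h4] at h3
    nlinarith
  rcases hz.eq_or_mem_spectrum hd hinj hst hprof.off hu with rfl | hz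
  · simp only [Complex.neg_re, Complex.one_re]
    linarith
  · refine hball (y := (fun k => u (p k) / n, fun k j => n * cycleGreen d (p k - p j))) ?_ hz
    rw [Prod.dist_eq]
    refine max_lt ((dist_pi_lt_iff hρ).2 fun k => ?_)
      ((dist_pi_lt_iff hρ).2 fun k => (dist_pi_lt_iff hρ).2 fun j => h2 k j)
    have e : u (p k) / n - V k = (u (p k) - n * V k) / n := by field_simp
    rw [Real.dist_eq, e, abs_div, abs_of_pos hn0, div_lt_iff₀ hn0]
    calc |u (p k) - n * V k| ≤ ε * (n * V k) := hprof.spike k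
      _ = ε * V k * n := by ring
      _ < ρ * n := mul_lt_mul_of_pos_right (hεV k) hn0

theorem mainTheorem7 (K : ℕ) (hK : 0 < K) (d : ℝ) (hd : 0 < d)
    (x : Fin K → UnitAddCircle) (hx : Function.Injective x)
    (V : Fin K → ℝ) (hV : ∀ k, 0 < V k)
    (hsys : ∀ k, V k = ∑ j, V j ^ 2 * Gper d (x k) (x j)) :
    -- existence of the spike state with the asserted leading-order profile
    (IsUnit (1 - spikeMatrix d x V) →
      ∀ ε : ℝ, 0 < ε → ∃ δ : ℝ, 0 < δ ∧ ∃ N : ℕ, ∀ (n : ℕ) [NeZero n], N ≤ n →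
        ∀ p : Fin K → ZMod n, NodesNear δ x p →
          ∃ u v : ZMod n → ℝ, IsSteadyState 0 (d ^ 2 * (n : ℝ) ^ 2) u v ∧
            HasSpikeProfile ε d x V p u v) ∧
    -- stability of every spike state with that profile
    ((∀ z ∈ spectrum ℂ ((1 - spikeMatrix d x V).map (algebraMap ℝ ℂ)), z.re ≤ 0) →
      (IsUnit (1 - spikeMatrix d x V) →
        ∃ ε : ℝ, 0 < ε ∧ ∃ δ : ℝ, 0 < δ ∧ ∃ N : ℕ, ∀ (n : ℕ) [NeZero n], N ≤ n →
          ∀ p : Fin K → ZMod n, NodesNear δ x p →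
            ∀ u v : ZMod n → ℝ, IsSteadyState 0 (d ^ 2 * (n : ℝ) ^ 2) u v →
              HasSpikeProfile ε d x V p u v →
                IsLinearlyStable 0 (d ^ 2 * (n : ℝ) ^ 2) 0 u v) ∧
      (∀ η : ℝ, 0 < η →
        ∃ ε : ℝ, 0 < ε ∧ ∃ δ : ℝ, 0 < δ ∧ ∃ N : ℕ, ∀ (n : ℕ) [NeZero n], N ≤ n →
          ∀ p : Fin K → ZMod n, NodesNear δ x p →
            ∀ u v : ZMod n → ℝ, IsSteadyState 0 (d ^ 2 * (n : ℝ) ^ 2) u v →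
              HasSpikeProfile ε d x V p u v →
                ∀ z : ℂ, IsGrowthRate 0 (d ^ 2 * (n : ℝ) ^ 2) 0 u v z → z.re ≤ η)) := by
  refine ⟨fun hU ε hε => exists_spikeState hK hd hx hV hsys hU hε, fun hspec => ⟨fun hU => ?_, ?_⟩⟩
  · refine exists_forall_isGrowthRate_re_lt hd hx hV le_rfl fun z hz =>
      (hspec z hz).lt_of_ne fun hre => ?_
    -- A spectral point on the imaginary axis is real, hence `0`, contradicting invertibility.
    have him : z.im = 0 := im_eq_zero_of_mem_spectrum (G := fun k j => Gper d (x k) (x j))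
      (fun k j => Gper_comm d _ _) (w := fun k => 2 * V k)
      (fun k => mul_pos two_pos (hV k)) hz
    obtain rfl : z = 0 := Complex.ext hre him
    exact spectrum.zero_notMem_iff ℂ |>.2 (hU.map (algebraMap ℝ ℂ).mapMatrix) hz
  · intro η hη
    obtain ⟨ε, hε, δ, hδ, N, h⟩ := exists_forall_isGrowthRate_re_lt hd hx hV hη.le
      fun z hz => (hspec z hz).trans_lt hη
    exact ⟨ε, hε, δ, hδ, N, fun n _ hn p hp u v hst hprof z hz =>
      (h n hn p hp u v hst hprof z hz).le⟩
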